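/- Let $\mathbb K$ be an algebraically closed field (of any characteristic) and let $P(x,y,T)=p(x,y)-T\,x^cU(x,y)$ be a special pencil, i.e. $p,U\in\mathbb K[[x,y]]$, $c>0$, $U$ is a unit, and $x$ does not divide $p$. Write $P=\sum A_{i,j}x^iy^j$ with $A_{i,j}\in\mathbb K[T]$. An edge $\ell$ of the Newton polygon of $P$ (a compact one-dimensional face of the convex hull of $\operatorname{supp}(P)+\mathbb N^2$) lies on a line $ni+mj=\omega$ with $n,m>0$ coprime; $n$ is its v-ratio. Its quasi-homogeneous part is $P_\ell=x^uy^vq_\ell(x^m,y^n)$ with $q_\ell$ homogeneous of degree $d_\ell$ and prime to $s_1s_2$. The edge is dicritical if $(c,0)$ is one of its vertices. The toric-Newton process starts with $P$ and repeats the following steps. For a non-dicritical edge $\ell$ and a root $\alpha$ of $q_\ell(1,s)$, substitute $(x,y)=(x_1^n(\bar y_1+\alpha)^a,\;x_1^m(\bar y_1+\alpha)^b)$ with $bn-am=1$, and divide by $x_1^\omega(\bar y_1+\alpha)^{\tilde v}$, where $\tilde v=\min\{ai+bj: A_{i,j}\neq0\}$. If, however, $n=1$ and $P_\ell$ is proportional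 to $(y-Bx^m)^{d_\ell}$ with $B\in\mathbb K$, substitute $y=y_1+Bx^m$ instead. All the series obtained are special pencils. Let $E$ be a dicritical divisor of $P$, given by a dicritical edge $\ell$ (with v-ratio $n$ and h-ratio $m$) of a special pencil $Q=\tilde p-T x^{\tilde c}\tilde U$ in this process. Put $d_E=d_\ell$ and let $q_E\in\mathbb K[z]$, of degree $d_E$, be the polynomial with $q_\ell(1,z)=\tilde U(0,0)\,(q_E(z)-T)$; it is the restriction to $E$ of the pull-back of $p/(x^cU)$. Here $E=\{x_1=0\}$, with coordinate $z=y_1$, in the chart $(x,y)=(x_1^ny_1^a,x_1^my_1^b)$ with $bn-am=1$, $0\le a<n$; the line $y_1=0$ is also exceptional when $n>1$. A curvette of $E$ is a nonsingular branch that meets $E$ transversally. A value $t\in\mathbb K$ is called typical for $P$ at $E$ if the strict transform of the curve $P(x,y,t)=0$ contains exactly $d_E$ curvettes of $E$ and these meet $E$ at $d_E$ distinct points, and atypical for $P$ at $E$ otherwise. Assume that $q_E$ is separable, i.e. $q_E'$ is not identically zero. Put $A_E^*=\{q_E(\alpha): \alpha\in\mathbb K,\ q_E'(\alpha)=0\}$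 and $t_{0,E}=q_E(0)$. Then: (1) every $t\in A_E^*$ is an atypical value for $P$ at $E$; (2) if $n>1$, then $t_{0,E}$ is an atypical value for $P$ at $E$, regardless of the value of $q_E'$ at $0$. -/

import Mathlib

noncomputable section

namespace DicriticalPencil

open MvPowerSeries

/-- The exponent of the monomial `x ^ i * y ^ j`; the variables are `x = X 0`, `y = X 1`. -/
def expo (i j : ℕ) : Fin 2 →₀ ℕ := Finsupp.single 0 i + Finsupp.single 1 j

/-- A special pencil `P(x, y, T) = p(x, y) - T * x ^ c * U(x, y)` over the field `K`: `c > 0`,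
`U` is a unit of `K[[x, y]]` and `x` does not divide `p`. -/
structure SpecialPencil (K : Type*) [Field K] where
  p : MvPowerSeries (Fin 2) K
  U : MvPowerSeries (Fin 2) K
  c : ℕ
  c_pos : 0 < c
  isUnit_U : IsUnit U
  not_dvd : ¬ (X 0 : MvPowerSeries (Fin 2) K) ∣ p

namespace SpecialPencil

variable {K : Type*} [Field K]

/-- The denominator `x ^ c * U(x, y)` of the meromorphic germ. -/
def den (P : SpecialPencil K) : MvPowerSeries (Fin 2) K := X 0 ^ P.c * P.U

/-- The pencil as a power series `P(x, y, T)` in `x, y` with coefficients in `K[T]`. -/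
def series (P : SpecialPencil K) : MvPowerSeries (Fin 2) (Polynomial K) :=
  map Polynomial.C P.p - C Polynomial.X * map Polynomial.C P.den

/-- The member `P(x, y, t)` of the pencil. -/
def curve (P : SpecialPencil K) (t : K) : MvPowerSeries (Fin 2) K := P.p - C t * P.den

/-- The coefficient `A i j` of `x ^ i * y ^ j` in `P(x, y, T)`, a polynomial in `T`. -/
def A (P : SpecialPencil K) (i j : ℕ) : Polynomial K := coeff (expo i j) P.series

/-- A compact edge of the Newton polygon of `P(x, y, T)`: the segment with end points
`(u, v + n * d)` and `(u + m * d, v)`, which are in the support of `P`, on a line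
`n * i + m * j = ω` with `n, m` positive and coprime, such that the support of `P` lies
in `n * i + m * j ≥ ω` and meets the line only inside the segment. -/
structure NewtonEdge (P : SpecialPencil K) where
  n : ℕ
  m : ℕ
  u : ℕ
  v : ℕ
  d : ℕ
  n_pos : 0 < n
  m_pos : 0 < m
  d_pos : 0 < d
  coprime : Nat.Coprime n m
  top_mem : P.A u (v + n * d) ≠ 0
  bottom_mem : P.A (u + m * d) v ≠ 0
  le_weight : ∀ i j : ℕ, P.A i j ≠ 0 → n * (u + m * d) + m * v ≤ n * i + m * j
  mem_segment : ∀ i j : ℕ, P.A i j ≠ 0 → n * i + m * j = n * (u + m * d) + m * v →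
    u ≤ i ∧ v ≤ j

namespace NewtonEdge

variable {P : SpecialPencil K}

/-- The weighted degree `ω` of the edge. -/
def weight (e : NewtonEdge P) : ℕ := e.n * (e.u + e.m * e.d) + e.m * e.v

/-- The polynomial `q(1, s)` in `K[T][s]`, where `x ^ u * y ^ v * q(x ^ m, y ^ n)` is the
quasi-homogeneous part of `P` on the edge, with `q` homogeneous of degree `d`. -/
def edgePoly (e : NewtonEdge P) : Polynomial (Polynomial K) :=
  ∑ k ∈ Finset.range (e.d + 1),
    Polynomial.C (P.A (e.u + e.m * (e.d - k)) (e.v + e.n * k)) * Polynomial.X ^ k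

/-- The edge is dicritical: `(c, 0)` is a vertex of it. -/
def IsDicritical (e : NewtonEdge P) : Prop := e.v = 0 ∧ e.u + e.m * e.d = P.c

/-- The quasi-homogeneous part of `P` on the edge is proportional to `(y - B * x ^ m) ^ d`. -/
def IsPurePower (e : NewtonEdge P) (B : K) : Prop :=
  e.n = 1 ∧ e.u = 0 ∧ e.v = 0 ∧ ∃ β : K, e.edgePoly =
    Polynomial.C (Polynomial.C β) *
      (Polynomial.X - Polynomial.C (Polynomial.C B)) ^ e.d

end NewtonEdge

/-- The least power of `y₁` in the pull-back of `P` by `(x₁ ^ n * y₁ ^ a, x₁ ^ m * y₁ ^ b)`. -/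
def yOrder (P : SpecialPencil K) (a b : ℕ) : ℕ :=
  sInf {k : ℕ | ∃ i j : ℕ, P.A i j ≠ 0 ∧ k = a * i + b * j}

end SpecialPencil

variable {K : Type*} [Field K]

/-- The substitution `(x, y) = (x₁, y₁ + B * x₁ ^ m)`. -/
def translation (m : ℕ) (B : K) : Fin 2 → MvPowerSeries (Fin 2) K :=
  ![X 0, X 1 + C B * X 0 ^ m]

/-- The toric map `(x, y) = (x₁ ^ n * y₁ ^ a, x₁ ^ m * y₁ ^ b)` followed by the
translation `y₁ = y' + α`, in the variables `x₁ = X 0`, `y' = X 1`. -/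
def toricMap (n m a b : ℕ) (α : K) : Fin 2 → MvPowerSeries (Fin 2) K :=
  ![X 0 ^ n * (X 1 + C α) ^ a, X 0 ^ m * (X 1 + C α) ^ b]

/-- The toric-Newton process: `ToricNewton P φ Q` says that the special pencil `Q` occurs in
the toric-Newton process of `P`, where `φ` is the composition of the toric-Newton
transformations and translations which have been performed to reach `Q` from `P`. -/
inductive ToricNewton (P : SpecialPencil K) :
    (Fin 2 → MvPowerSeries (Fin 2) K) → SpecialPencil K → Prop
  | start : ToricNewton P (fun i => X i) P
  | translate (φ : Fin 2 → MvPowerSeries (Fin 2) K) (Q Q' : SpecialPencil K)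
      (h : ToricNewton P φ Q) (e : Q.NewtonEdge) (B : K) (he : e.IsPurePower B)
      (hp : Q.p.subst (translation e.m B) = Q'.p)
      (hden : Q.den.subst (translation e.m B) = Q'.den) :
      ToricNewton P (fun i => (φ i).subst (translation e.m B)) Q'
  | toric (φ : Fin 2 → MvPowerSeries (Fin 2) K) (Q Q' : SpecialPencil K)
      (h : ToricNewton P φ Q) (e : Q.NewtonEdge) (hdic : ¬ e.IsDicritical)
      (hpure : ∀ B : K, ¬ e.IsPurePower B) (a b : ℕ) (hab : b * e.n = a * e.m + 1)
      (α : K) (hα : e.edgePoly.eval (Polynomial.C α) = 0)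
      (hp : Q.p.subst (toricMap e.n e.m a b α) =
        X 0 ^ e.weight * (X 1 + C α) ^ Q.yOrder a b * Q'.p)
      (hden : Q.den.subst (toricMap e.n e.m a b α) =
        X 0 ^ e.weight * (X 1 + C α) ^ Q.yOrder a b * Q'.den) :
      ToricNewton P (fun i => (φ i).subst (toricMap e.n e.m a b α)) Q'

/-- A dicritical divisor `E` of the pencil `P`, given by a dicritical edge of the Newton polygon
of a special pencil `Q` in the toric-Newton process of `P`. -/
structure Dicritical (P : SpecialPencil K) where
  φ : Fin 2 → MvPowerSeries (Fin 2) K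
  Q : SpecialPencil K
  process : ToricNewton P φ Q
  edge : Q.NewtonEdge
  isDicritical : edge.IsDicritical

/-- `G` is an equation of the strict transform of a curve germ with total transform `F = 0`.
The exceptional divisor is `X 0 = 0` or, if `corner` holds, `X 0 * X 1 = 0`. -/
def IsStrictTransform (corner : Prop) (F G : MvPowerSeries (Fin 2) K) : Prop :=
  ∃ k l : ℕ, F = X 0 ^ k * X 1 ^ l * G ∧ ¬ X 0 ∣ G ∧
    (corner → ¬ X 1 ∣ G) ∧ (¬ corner → l = 0)

/-- The germ `f = 0` passes through the origin, is nonsingular there and is transversal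
to `E = {X 0 = 0}`. -/
def IsCurvette (f : MvPowerSeries (Fin 2) K) : Prop :=
  constantCoeff f = 0 ∧ coeff (expo 0 1) f ≠ 0

namespace Dicritical

variable {P : SpecialPencil K}

/-- The degree `d_E`. -/
def degree (E : Dicritical P) : ℕ := E.edge.d

/-- The v-ratio of the dicritical edge. -/
def vRatio (E : Dicritical P) : ℕ := E.edge.n

/-- The polynomial `q_E(z)`, the restriction to `E` of the pull-back of the meromorphic germ
`p / (x ^ c * U)`. On a dicritical edge `q(1, z) = U(0, 0) * (q_E(z) - T)`. -/
def q (E : Dicritical P) : Polynomial K :=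
  Polynomial.C (constantCoeff E.Q.U)⁻¹ * E.edge.edgePoly.map (Polynomial.evalRingHom 0)

/-- The set `A_E^*` of the critical values of `q_E`. -/
def criticalValues (E : Dicritical P) : Set K :=
  {t | ∃ α : K, E.q.derivative.eval α = 0 ∧ t = E.q.eval α}

/-- The curvettes of `E` among the branches of the strict transform of the curve `P(x, y, t) = 0`,
as pairs `(α, (f))`: `α` is the coordinate of a point of `E` and `f = 0` is a branch through
that point. Here `E = {x₁ = 0}` with coordinate `z = y₁` in the toric chart of the edge with
`b * n - a * m = 1`, `0 ≤ a < n`. The line `y₁ = 0` is exceptional exactly if `a > 0`, that is,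
if `n > 1`. At the remaining point `z = ∞` the pull-back of the germ has value `∞`, so that
no curve `P(x, y, t) = 0` with `t` in `K` has its strict transform through it. -/
def curvettes (E : Dicritical P) (t : K) : Set (K × Ideal (MvPowerSeries (Fin 2) K)) :=
  {z | ∃ (a b : ℕ) (G f : MvPowerSeries (Fin 2) K),
    a < E.edge.n ∧ b * E.edge.n = a * E.edge.m + 1 ∧
    IsStrictTransform (z.1 = 0 ∧ 0 < a)
      (((P.curve t).subst E.φ).subst (toricMap E.edge.n E.edge.m a b z.1)) G ∧
    Irreducible f ∧ f ∣ G ∧ IsCurvette f ∧ z.2 = Ideal.span {f}}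

/-- `t` is typical for `P` at `E`: the strict transform of `P(x, y, t) = 0` has exactly `d_E`
curvettes of `E`, and they meet `E` at distinct points. -/
def IsTypical (E : Dicritical P) (t : K) : Prop :=
  (E.curvettes t).encard = E.degree ∧ Set.InjOn Prod.fst (E.curvettes t)

/-- `t` is atypical for `P` at `E`. -/
def IsAtypical (E : Dicritical P) (t : K) : Prop := ¬ E.IsTypical t

end Dicritical

end DicriticalPencil

end

/-! In the toric chart of `E`, centred at the point `z`, the member `t` pulls back to powers of `x₁`
and `y₁` times a unit times `V = Q_t(y₁) + x₁ * R`, where `Q_t` (`edgePolyAt`) is a nonzero constant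
times `q_E - t` (`Dicritical.exists_subst_eq`, `edgePolyAt_eq`). The strict transform divides `V` up
to a unit, so curvettes meet `E` only at roots of `Q_t`, whose degree is at most `d_E`. A typical
value therefore needs `d_E` distinct roots, which a critical value of `q_E` cannot have. If `n > 1`,
then `a > 0` and `R` is divisible by `y₁`. When `0` is a simple root of `Q_t`, this gives `V = y₁ *
unit` there; as `y₁ = 0` is exceptional, no curvette passes through `0` and at most `d_E - 1` points
are left. When `0` is a multiple root, `t` is a critical value. -/

namespace DicriticalPencil

open MvPowerSeries

/-! ### Monomials and divisibility in power series rings. -/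

section PowerSeries

/-- By Dickson's lemma, a power series is a combination of finitely many of the monomials in
its support. -/
theorem exists_eq_sum_monomial_mul {σ R : Type*} [Finite σ] [CommSemiring R]
    (g : MvPowerSeries σ R) :
    ∃ (s : Finset (σ →₀ ℕ)) (h : (σ →₀ ℕ) → MvPowerSeries σ R),
      (∀ e ∈ s, coeff e g ≠ 0) ∧ g = ∑ e ∈ s, monomial e 1 * h e := by
  classical
  have hfin : {e | Minimal (fun e => coeff e g ≠ 0) e}.Finite :=
    (setOfPred_minimal_antichain _).finite_of_partiallyWellOrderedOn (Set.isPWO_of_wellQuasiOrderedLE _)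
  have hex : ∀ e, coeff e g ≠ 0 → ∃ b ≤ e, Minimal (fun e => coeff e g ≠ 0) b :=
    fun e he => exists_minimal_le_of_wellFoundedLT _ e he
  choose! c hc hmin using hex
  -- Each exponent `e` of the support is assigned to one minimal exponent `c e` below it; the
  -- cofactor of `b` collects the terms assigned to `b`, so that no term is counted twice.
  refine ⟨hfin.toFinset, fun b => show MvPowerSeries σ R from
      fun e => if c (b + e) = b then coeff (b + e) g else 0, fun e he => ?_, ?_⟩
  · exact Minimal.prop (P := fun e => coeff e g ≠ 0) ((Set.Finite.mem_toFinset hfin).1 he)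
  ext e
  rw [map_sum]
  have key : ∀ b ∈ hfin.toFinset, coeff e (monomial b 1 * (show MvPowerSeries σ R from
      fun e => if c (b + e) = b then coeff (b + e) g else 0)) =
      if b = c e then coeff e g else 0 := by
    intro b _
    rw [coeff_monomial_mul, one_mul]
    by_cases hb : b ≤ e
    · rw [if_pos hb]
      change (if c (b + (e - b)) = b then coeff (b + (e - b)) g else 0) = _
      rw [add_tsub_cancel_of_le hb]
      simp only [eq_comm]
    · rw [if_neg hb]
      split_ifs with h
      · by_contra h0
        exact hb (h ▸ hc e (Ne.symm h0))
      · rfl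
  rw [Finset.sum_congr rfl key, Finset.sum_ite_eq']
  split_ifs with h
  · rfl
  · by_contra h0
    exact h ((Set.Finite.mem_toFinset hfin).2 (hmin e h0))

theorem X_dvd_of_X_dvd_X_pow_mul {σ R : Type*} [CommSemiring R] {i j : σ} (hij : i ≠ j)
    {l : ℕ} {G : MvPowerSeries σ R} (h : X i ∣ X j ^ l * G) : X i ∣ G := by
  classical
  rw [X_dvd_iff] at h ⊢
  intro m hm
  have := h (Finsupp.single j l + m) (by simp [hm, hij.symm])
  rwa [X_pow_eq, coeff_add_monomial_mul, one_mul] at this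

variable {K : Type*} [Field K]

/-- A strict transform `G` has no exceptional factor, so the powers on the right can be cancelled
against those on the left. The alternative `M = 0` serves the charts where `X 1 = 0` is not
exceptional. -/
theorem dvd_of_X_pow_mul_eq {G V : MvPowerSeries (Fin 2) K} {k l N M : ℕ}
    (h : X 0 ^ k * X 1 ^ l * G = X 0 ^ N * X 1 ^ M * V)
    (h0 : ¬ X 0 ∣ G) (h1 : ¬ X 1 ∣ G ∨ M = 0) : G ∣ V := by
  have hX : ∀ (i : Fin 2) (r : ℕ), (X i ^ r : MvPowerSeries (Fin 2) K) ≠ 0 := fun i r =>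
    pow_ne_zero _ fun h0 => by
      simpa using congrArg (coeff (Finsupp.single i 1)) h0
  have hN : N ≤ k := by
    by_contra! hlt
    obtain ⟨r, rfl⟩ := Nat.exists_eq_add_of_lt hlt
    have e : X 1 ^ l * G = X 0 * (X 0 ^ r * X 1 ^ M * V) := by
      refine mul_left_cancel₀ (hX 0 k) ?_
      rw [← mul_assoc, h]
      ring
    exact h0 (X_dvd_of_X_dvd_X_pow_mul (by decide) ⟨_, e⟩)
  obtain ⟨r, rfl⟩ := Nat.exists_eq_add_of_le hN
  have hM : M ≤ l := by
    by_contra! hlt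
    obtain ⟨w, rfl⟩ := Nat.exists_eq_add_of_lt hlt
    have e : X 0 ^ r * G = X 1 * (X 1 ^ w * V) := by
      refine mul_left_cancel₀ (mul_ne_zero (hX 0 N) (hX 1 l)) ?_
      linear_combination h
    exact h1.elim (fun h1 => h1 (X_dvd_of_X_dvd_X_pow_mul (by decide) ⟨_, e⟩)) (by omega)
  obtain ⟨w, rfl⟩ := Nat.exists_eq_add_of_le hM
  refine ⟨X 0 ^ r * X 1 ^ w, ?_⟩
  refine mul_left_cancel₀ (mul_ne_zero (hX 0 N) (hX 1 M)) ?_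
  linear_combination -h

theorem isUnit_X_add_C {z : K} (hz : z ≠ 0) :
    IsUnit (X 1 + C z : MvPowerSeries (Fin 2) K) := by
  rw [isUnit_iff_constantCoeff]
  simpa using hz

theorem monomial_expo (i j : ℕ) :
    monomial (expo i j) (1 : K) = X 0 ^ i * X 1 ^ j := by
  rw [X_pow_eq, X_pow_eq, monomial_mul_monomial, one_mul, expo]

theorem expo_apply (e : Fin 2 →₀ ℕ) : expo (e 0) (e 1) = e := by
  ext i
  fin_cases i <;> simp [expo]

theorem expo_inj {i j i' j' : ℕ} : expo i j = expo i' j' ↔ i = i' ∧ j = j' := by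
  constructor
  · intro h
    have h0 := DFunLike.congr_fun h 0
    have h1 := DFunLike.congr_fun h 1
    simp [expo] at h0 h1
    exact ⟨h0, h1⟩
  · rintro ⟨rfl, rfl⟩
    rfl

end PowerSeries

/-! ### Pull-back by toric maps and by the toric-Newton process. -/

section Substitution

variable {K : Type*} [Field K]

theorem hasSubst_toricMap {n m : ℕ} (hn : 0 < n) (hm : 0 < m) (a b : ℕ) (α : K) :
    HasSubst (toricMap n m a b α) := by
  apply hasSubst_of_constantCoeff_zero
  intro i
  fin_cases i <;> simp [toricMap, hn.ne', hm.ne']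

theorem hasSubst_translation {m : ℕ} (hm : 0 < m) (B : K) : HasSubst (translation m B) := by
  apply hasSubst_of_constantCoeff_zero
  intro i
  fin_cases i <;> simp [translation, hm.ne']

theorem isUnit_subst {a : Fin 2 → MvPowerSeries (Fin 2) K} (ha : HasSubst a)
    {f : MvPowerSeries (Fin 2) K} (hf : IsUnit f) : IsUnit (f.subst a) := by
  rw [← substAlgHom_apply (R := K) ha]
  exact hf.map _

theorem subst_toricMap_X_pow_mul {n m : ℕ} (hn : 0 < n) (hm : 0 < m) (a b : ℕ) (z : K)
    (i j : ℕ) : (X 0 ^ i * X 1 ^ j : MvPowerSeries (Fin 2) K).subst (toricMap n m a b z) =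
      X 0 ^ (n * i + m * j) * (X 1 + C z) ^ (a * i + b * j) := by
  have hs := hasSubst_toricMap hn hm a b z
  rw [subst_mul hs, subst_pow hs, subst_pow hs, subst_X hs, subst_X hs]
  simp only [toricMap, Matrix.cons_val_zero, Matrix.cons_val_one]
  ring

/-- Dickson's lemma reduces the infinite series to finitely many monomials of its support, and the
image of each is divisible. -/
theorem dvd_subst_toricMap {n m : ℕ} (hn : 0 < n) (hm : 0 < m) (a b : ℕ) (z : K) {N M : ℕ}
    {g : MvPowerSeries (Fin 2) K}
    (hg : ∀ i j, coeff (expo i j) g ≠ 0 → N ≤ n * i + m * j ∧ M ≤ a * i + b * j) :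
    X 0 ^ N * (X 1 + C z) ^ M ∣ g.subst (toricMap n m a b z) := by
  obtain ⟨s, h, hs, e⟩ := exists_eq_sum_monomial_mul g
  have hS := hasSubst_toricMap hn hm a b z
  rw [e, ← substAlgHom_apply (R := K) hS, map_sum]
  refine Finset.dvd_sum fun d hd => ?_
  rw [map_mul]
  refine Dvd.dvd.mul_right ?_ _
  have hd' := hs d hd
  rw [← expo_apply d] at hd' ⊢
  rw [monomial_expo, substAlgHom_apply, subst_toricMap_X_pow_mul hn hm]
  obtain ⟨h1, h2⟩ := hg _ _ hd'
  exact mul_dvd_mul (pow_dvd_pow _ h1) (pow_dvd_pow _ h2)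

/-- After the transformations of the toric-Newton process the pencil is, up to a power of `x`
and a unit, the special pencil which has been reached. -/
theorem ToricNewton.exists_subst_eq {P Q : SpecialPencil K}
    {φ : Fin 2 → MvPowerSeries (Fin 2) K} (h : ToricNewton P φ Q) :
    HasSubst φ ∧ ∃ (k : ℕ) (W : MvPowerSeries (Fin 2) K), IsUnit W ∧
      P.p.subst φ = X 0 ^ k * W * Q.p ∧ P.den.subst φ = X 0 ^ k * W * Q.den := by
  induction h with
  | start =>
    refine ⟨HasSubst.X, 0, 1, isUnit_one, ?_, ?_⟩ <;>
    · change subst X _ = _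
      rw [subst_self]
      simp
  | translate φ Q Q' h e B he hp hden ih =>
    obtain ⟨hφ, k, W, hW, h1, h2⟩ := ih
    have hs := hasSubst_translation e.m_pos B
    refine ⟨by simpa using hφ.comp hs, k, W.subst (translation e.m B), isUnit_subst hs hW, ?_, ?_⟩
    · rw [← subst_comp_subst_apply hφ hs, h1, subst_mul hs, subst_mul hs, subst_pow hs,
        subst_X hs, hp]
      rfl
    · rw [← subst_comp_subst_apply hφ hs, h2, subst_mul hs, subst_mul hs, subst_pow hs,
        subst_X hs, hden]
      rfl
  | toric φ Q Q' h e hdic hpure a b hab α hα hp hden ih =>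
    obtain ⟨hφ, k, W, hW, h1, h2⟩ := ih
    have hs := hasSubst_toricMap e.n_pos e.m_pos a b α
    -- The constant term of the edge polynomial is the coefficient at the lower vertex. Hence `α ≠
    -- 0`, and the powers of `X 1 + C α` are units.
    have hα0 : α ≠ 0 := by
      rintro rfl
      apply e.bottom_mem
      rw [map_zero, ← Polynomial.coeff_zero_eq_eval_zero] at hα
      simpa [SpecialPencil.NewtonEdge.edgePoly, Polynomial.coeff_X_pow] using hα
    have hu := isUnit_X_add_C hα0
    refine ⟨by simpa using hφ.comp hs, e.n * k + e.weight,
      (X 1 + C α) ^ (a * k + Q.yOrder a b) * W.subst (toricMap e.n e.m a b α),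
      (hu.pow _).mul (isUnit_subst hs hW), ?_, ?_⟩
    · rw [← subst_comp_subst_apply hφ hs, h1, subst_mul hs, subst_mul hs, subst_pow hs,
        subst_X hs, hp]
      simp only [toricMap, Matrix.cons_val_zero]
      ring
    · rw [← subst_comp_subst_apply hφ hs, h2, subst_mul hs, subst_mul hs, subst_pow hs,
        subst_X hs, hden]
      simp only [toricMap, Matrix.cons_val_zero]
      ring

end Substitution

/-! ### Members of a special pencil along a dicritical edge. -/

namespace SpecialPencil

variable {K : Type*} [Field K] (P : SpecialPencil K)

theorem A_eq (i j : ℕ) : P.A i j =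
    Polynomial.C (coeff (expo i j) P.p) - Polynomial.X * Polynomial.C (coeff (expo i j) P.den) := by
  simp [A, series, coeff_C_mul]

theorem coeff_curve (t : K) (i j : ℕ) : coeff (expo i j) (P.curve t) = (P.A i j).eval t := by
  rw [A_eq, curve, map_sub, coeff_C_mul, mul_comm]
  simp

theorem coeff_den_of_lt {i j : ℕ} (h : i < P.c) : coeff (expo i j) P.den = 0 := by
  have : X 0 ^ P.c ∣ P.den := dvd_mul_right _ _
  rw [X_pow_dvd_iff] at this
  exact this _ (by simpa [expo] using h)

theorem coeff_den_c : coeff (expo P.c 0) P.den = constantCoeff P.U := by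
  have := coeff_add_monomial_mul (Finsupp.single 0 P.c) 0 P.U (1 : K)
  rw [← X_pow_eq] at this
  simpa [expo, den] using this

theorem constantCoeff_U_ne_zero : constantCoeff P.U ≠ 0 :=
  (P.isUnit_U.map (constantCoeff (σ := Fin 2) (R := K))).ne_zero

theorem subst_curve {φ : Fin 2 → MvPowerSeries (Fin 2) K} (hφ : HasSubst φ) (t : K) :
    (P.curve t).subst φ = P.p.subst φ - C t * P.den.subst φ := by
  rw [curve, subst_sub hφ, ← smul_eq_C_mul, subst_smul hφ, smul_eq_C_mul]

/-- The restriction of the edge polynomial to the member `t` of the pencil. -/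
noncomputable def NewtonEdge.edgePolyAt {P : SpecialPencil K} (e : P.NewtonEdge) (t : K) : Polynomial K :=
  e.edgePoly.map (Polynomial.evalRingHom t)

namespace NewtonEdge

variable {P} (e : P.NewtonEdge)

theorem edgePolyAt_eq_sum (t : K) : e.edgePolyAt t = ∑ k ∈ Finset.range (e.d + 1),
    Polynomial.C (coeff (expo (e.u + e.m * (e.d - k)) (e.v + e.n * k)) (P.curve t)) *
      Polynomial.X ^ k := by
  simp [edgePolyAt, edgePoly, Polynomial.map_sum, coeff_curve]

theorem natDegree_edgePolyAt_le (t : K) : (e.edgePolyAt t).natDegree ≤ e.d := by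
  rw [edgePolyAt_eq_sum]
  refine Polynomial.natDegree_sum_le_of_forall_le _ _ fun k hk => ?_
  exact (Polynomial.natDegree_C_mul_X_pow_le _ _).trans
    (Nat.lt_succ_iff.1 (Finset.mem_range.1 hk))

/-- All lattice points of the edge other than the vertex `(c, 0)` have abscissa less than `c`, and
`x ^ c` divides the denominator, so `t` enters only the constant term. -/
theorem edgePolyAt_eq_sub (he : e.IsDicritical) (t : K) : e.edgePolyAt t =
    e.edgePolyAt 0 - Polynomial.C (t * constantCoeff P.U) := by
  obtain ⟨hv, hc⟩ := he
  rw [edgePolyAt_eq_sum, edgePolyAt_eq_sum, Finset.sum_range_succ', Finset.sum_range_succ',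
    add_sub_assoc]
  congr 1
  · refine Finset.sum_congr rfl fun k hk => ?_
    have hlt : e.u + e.m * (e.d - (k + 1)) < P.c := by
      have := Finset.mem_range.1 hk
      have := Nat.mul_lt_mul_of_pos_left (show e.d - (k + 1) < e.d by omega) e.m_pos
      omega
    simp [coeff_curve, A_eq, P.coeff_den_of_lt hlt]
  · simp only [coeff_curve, A_eq]
    simp [hv, hc, coeff_den_c, -Polynomial.X_mul_C]

/-- The lattice points of the support which lie on a dicritical edge. -/
theorem exists_of_weight_eq (hv : e.v = 0) {i j : ℕ} (hA : P.A i j ≠ 0)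
    (h : e.n * i + e.m * j = e.n * (e.u + e.m * e.d)) :
    ∃ k ≤ e.d, i = e.u + e.m * (e.d - k) ∧ j = e.n * k := by
  have hu := (e.mem_segment i j hA (by rw [h, hv]; simp)).1
  have hdvd : e.n ∣ e.m * j :=
    (Nat.dvd_add_right (dvd_mul_right _ i)).1 (h ▸ dvd_mul_right _ _)
  obtain ⟨k, rfl⟩ := e.coprime.dvd_of_dvd_mul_left hdvd
  have h' : i + e.m * k = e.u + e.m * e.d := by
    refine Nat.eq_of_mul_eq_mul_left e.n_pos ?_
    rw [← h]
    ring
  have hk : k ≤ e.d := Nat.le_of_mul_le_mul_left (by omega) e.m_pos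
  refine ⟨k, hk, ?_, rfl⟩
  rw [Nat.mul_sub]
  have := Nat.mul_le_mul_left e.m hk
  omega

/-- The pull-back of a member of the pencil to the toric chart of a dicritical edge. -/
theorem subst_curve_eq (he : e.IsDicritical) {a b : ℕ} (hab : b * e.n = a * e.m + 1)
    (t z : K) {ε : ℕ} (hε : ε = 0 ∨ ε = 1 ∧ 0 < a) : ∃ R : MvPowerSeries (Fin 2) K,
    (P.curve t).subst (toricMap e.n e.m a b z) =
      X 0 ^ (e.n * P.c) * (X 1 + C z) ^ (a * P.c) *
        ((e.edgePolyAt t).aeval (X 1 + C z) + X 0 * (X 1 + C z) ^ ε * R) := by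
  classical
  obtain ⟨hv, hc⟩ := he
  have hS := hasSubst_toricMap e.n_pos e.m_pos a b z
  -- `L` is the part of the curve on the edge; it produces the polynomial term, and the rest is
  -- divisible by a further `X 0`.
  set L : MvPowerSeries (Fin 2) K := ∑ k ∈ Finset.range (e.d + 1),
    C (coeff (expo (e.u + e.m * (e.d - k)) (e.n * k)) (P.curve t)) *
      (X 0 ^ (e.u + e.m * (e.d - k)) * X 1 ^ (e.n * k)) with hL
  have hLs : L.subst (toricMap e.n e.m a b z) =
      X 0 ^ (e.n * P.c) * (X 1 + C z) ^ (a * P.c) * (e.edgePolyAt t).aeval (X 1 + C z) := by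
    rw [← substAlgHom_apply (R := K) hS, hL, map_sum, edgePolyAt_eq_sum, map_sum,
      Finset.mul_sum]
    refine Finset.sum_congr rfl fun k hk => ?_
    have hk : k ≤ e.d := Nat.lt_succ_iff.1 (Finset.mem_range.1 hk)
    rw [← smul_eq_C_mul, map_smul, substAlgHom_apply,
      subst_toricMap_X_pow_mul e.n_pos e.m_pos, hv, zero_add]
    obtain ⟨r, hr⟩ := Nat.exists_eq_add_of_le hk
    have h1 : e.n * (e.u + e.m * (e.d - k)) + e.m * (e.n * k) = e.n * P.c := by
      rw [← hc, hr, Nat.add_sub_cancel_left]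
      ring
    have h2 : a * (e.u + e.m * (e.d - k)) + b * (e.n * k) = a * P.c + k := by
      rw [← hc, hr, Nat.add_sub_cancel_left, ← mul_assoc, hab]
      ring
    rw [h1, h2, map_mul, map_pow, Polynomial.aeval_X, Polynomial.aeval_C, Algebra.smul_def]
    ring
  have hdvd : X 0 ^ (e.n * P.c + 1) * (X 1 + C z) ^ (a * P.c + ε) ∣
      (P.curve t - L).subst (toricMap e.n e.m a b z) := by
    refine dvd_subst_toricMap e.n_pos e.m_pos a b z fun i j hij => ?_
    have hcL : coeff (expo i j) L = ∑ k ∈ Finset.range (e.d + 1),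
        if i = e.u + e.m * (e.d - k) ∧ j = e.n * k then coeff (expo i j) (P.curve t) else 0 := by
      rw [hL, map_sum]
      refine Finset.sum_congr rfl fun k _ => ?_
      rw [coeff_C_mul, ← monomial_expo, coeff_monomial]
      simp only [expo_inj]
      split_ifs with h
      · rw [mul_one, ← h.1, ← h.2]
      · rw [mul_zero]
    have hw : e.n * P.c + 1 ≤ e.n * i + e.m * j := by
      by_contra! hlt
      have hA : P.A i j ≠ 0 := by
        intro h0
        have h1 : coeff (expo i j) (P.curve t) = 0 := by rw [coeff_curve, h0]; simp
        rw [map_sub, hcL] at hij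
        simp [h1] at hij
      have hle := e.le_weight i j hA
      rw [hv, hc] at hle
      obtain ⟨k, hk, rfl, rfl⟩ := e.exists_of_weight_eq hv hA (by rw [hc]; omega)
      rw [map_sub, hcL, Finset.sum_eq_single k, if_pos ⟨rfl, rfl⟩, sub_self] at hij
      · exact hij rfl
      · rintro k' - hne
        refine if_neg fun h => hne ?_
        exact (Nat.eq_of_mul_eq_mul_left e.n_pos h.2).symm
      · intro h
        exact absurd (Finset.mem_range.2 (Nat.lt_succ_of_le hk)) h
    refine ⟨hw, ?_⟩
    -- This identity turns weight at least `n * c + 1` into `n * (a * i + b * j) ≥ n * (a * c) + a`.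
    -- For `a > 0` the inequality is strict after division by `n`, which yields the extra factor for
    -- `ε = 1`.
    have h3 : e.n * (a * i + b * j) = a * (e.n * i + e.m * j) + j := by
      linear_combination j * hab
    have h4 : a * (e.n * P.c + 1) ≤ a * (e.n * i + e.m * j) := Nat.mul_le_mul_left a hw
    have h5 : e.n * (a * P.c) + a ≤ e.n * (a * i + b * j) := by
      rw [h3]
      linarith
    obtain rfl | ⟨rfl, ha⟩ := hε
    · exact Nat.le_of_mul_le_mul_left (by rw [add_zero]; omega) e.n_pos
    · exact Nat.lt_of_mul_lt_mul_left (a := e.n) (by omega)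
  obtain ⟨R, hR⟩ := hdvd
  refine ⟨R, ?_⟩
  have : (P.curve t).subst (toricMap e.n e.m a b z) = L.subst (toricMap e.n e.m a b z) +
      (P.curve t - L).subst (toricMap e.n e.m a b z) := by
    rw [← subst_add hS]
    congr 1
    ring
  rw [this, hLs, hR]
  ring

end NewtonEdge

end SpecialPencil

/-! ### Location and number of the curvettes. -/

namespace Dicritical

variable {K : Type*} [Field K] {P : SpecialPencil K} (E : Dicritical P)

theorem edgePolyAt_eq (t : K) : E.edge.edgePolyAt t =
    Polynomial.C (constantCoeff E.Q.U) * (E.q - Polynomial.C t) := by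
  have h : E.q = Polynomial.C (constantCoeff E.Q.U)⁻¹ * E.edge.edgePolyAt 0 := rfl
  rw [E.edge.edgePolyAt_eq_sub E.isDicritical, h, mul_sub, ← mul_assoc, ← Polynomial.C_mul,
    mul_inv_cancel₀ E.Q.constantCoeff_U_ne_zero, ← Polynomial.C_mul, mul_comm t]
  simp

theorem exists_subst_eq {a b : ℕ} (hab : b * E.edge.n = a * E.edge.m + 1) (t z : K) {ε : ℕ}
    (hε : ε = 0 ∨ ε = 1 ∧ 0 < a) : ∃ (k : ℕ) (W R : MvPowerSeries (Fin 2) K), IsUnit W ∧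
    ((P.curve t).subst E.φ).subst (toricMap E.edge.n E.edge.m a b z) =
      X 0 ^ (E.edge.n * k) * (X 1 + C z) ^ (a * k) * (W *
        ((E.edge.edgePolyAt t).aeval (X 1 + C z) + X 0 * (X 1 + C z) ^ ε * R)) := by
  obtain ⟨hφ, k, W, hW, h1, h2⟩ := E.process.exists_subst_eq
  have hS := hasSubst_toricMap E.edge.n_pos E.edge.m_pos a b z
  obtain ⟨R, hR⟩ := E.edge.subst_curve_eq E.isDicritical hab t z hε
  refine ⟨k + E.Q.c, W.subst (toricMap E.edge.n E.edge.m a b z), R, isUnit_subst hS hW, ?_⟩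
  have : (P.curve t).subst E.φ = X 0 ^ k * W * E.Q.curve t := by
    rw [P.subst_curve hφ, h1, h2, SpecialPencil.curve]
    ring
  rw [this, subst_mul hS, hR, subst_mul hS, subst_pow hS, subst_X hS]
  simp only [toricMap, Matrix.cons_val_zero]
  ring

theorem constantCoeff_aeval (p : Polynomial K) (z : K) :
    constantCoeff (p.aeval (X 1 + C z : MvPowerSeries (Fin 2) K)) = p.eval z := by
  rw [Polynomial.aeval_def, Polynomial.hom_eval₂]
  have : (constantCoeff (σ := Fin 2) (R := K)).comp (algebraMap K (MvPowerSeries (Fin 2) K)) =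
      RingHom.id K := by
    ext x
    simp [MvPowerSeries.algebraMap_apply]
  rw [this]
  simp [Polynomial.eval₂_id]

/-- Off the roots the cofactor of the monomial factors is a unit, hence so is the strict transform,
and no branch passes. -/
theorem eval_edgePolyAt_eq_zero_of_mem_curvettes {t : K}
    {x : K × Ideal (MvPowerSeries (Fin 2) K)} (hx : x ∈ E.curvettes t) :
    (E.edge.edgePolyAt t).eval x.1 = 0 := by
  obtain ⟨a, b, G, f, -, hab, ⟨k', l, hF, hG0, hG1, hl⟩, -, hfG, ⟨hf, -⟩, -⟩ := hx
  obtain ⟨k, W, R, hW, h⟩ := E.exists_subst_eq hab t x.1 (ε := 0) (Or.inl rfl)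
  by_contra hne
  have hu : IsUnit (W * ((E.edge.edgePolyAt t).aeval (X 1 + C x.1) +
      X 0 * (X 1 + C x.1) ^ 0 * R)) := by
    refine hW.mul ?_
    rw [isUnit_iff_constantCoeff]
    simpa [constantCoeff_aeval] using hne
  have hGu : IsUnit G := by
    rw [hF] at h
    -- At `z = 0` the power of `X 1` is exceptional, or trivial if `a = 0`; elsewhere `X 1 + C z` is
    -- a unit and is absorbed into the cofactor.
    by_cases hz : x.1 = 0
    · rw [hz, map_zero, add_zero] at h
      rw [hz, map_zero, add_zero] at hu
      refine isUnit_of_dvd_unit (dvd_of_X_pow_mul_eq h hG0 ?_) hu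
      rcases Nat.eq_zero_or_pos a with rfl | ha
      · exact Or.inr (zero_mul k)
      · exact Or.inl (hG1 ⟨hz, ha⟩)
    · refine isUnit_of_dvd_unit
        (dvd_of_X_pow_mul_eq (k := k') (l := l) (N := E.edge.n * k) (M := 0)
          (h.trans ?_) hG0 (Or.inr rfl)) (((isUnit_X_add_C hz).pow (a * k)).mul hu)
      ring
  have := (isUnit_of_dvd_unit hfG hGu).map (constantCoeff (σ := Fin 2) (R := K))
  exact this.ne_zero hf

theorem fst_ne_zero_of_mem_curvettes (hn : 1 < E.edge.n) {t : K}
    (h0 : (E.edge.edgePolyAt t).eval 0 = 0) (h1 : (E.edge.edgePolyAt t).derivative.eval 0 ≠ 0)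
    {x : K × Ideal (MvPowerSeries (Fin 2) K)} (hx : x ∈ E.curvettes t) : x.1 ≠ 0 := by
  obtain ⟨a, b, G, f, -, hab, ⟨k', l, hF, hG0, hG1, -⟩, -, hfG, ⟨hf, -⟩, -⟩ := hx
  intro hz
  have ha : 0 < a := by
    rcases Nat.eq_zero_or_pos a with rfl | ha
    · rw [zero_mul, zero_add] at hab
      have := Nat.eq_one_of_mul_eq_one_left hab
      omega
    · exact ha
  obtain ⟨k, W, R, hW, h⟩ := E.exists_subst_eq hab t x.1 (ε := 1) (Or.inr ⟨rfl, ha⟩)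
  obtain ⟨r, hr⟩ := Polynomial.X_dvd_iff.2 ((Polynomial.coeff_zero_eq_eval_zero _).trans h0)
  have hr0 : r.eval 0 ≠ 0 := by
    rw [hr] at h1
    simpa using h1
  rw [hz, map_zero, add_zero, hr, map_mul, Polynomial.aeval_X] at h
  rw [hz] at hF
  rw [hF] at h
  have hu : IsUnit (W * (r.aeval (X 1 + C 0) + X 0 * R)) := by
    refine hW.mul ?_
    rw [isUnit_iff_constantCoeff]
    simpa [-map_zero, -add_zero, constantCoeff_aeval] using hr0
  rw [map_zero, add_zero] at hu
  -- The simple root contributes the `+ 1` in the power of the exceptional `X 1`; what remains is a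
  -- unit.
  have hd := dvd_of_X_pow_mul_eq (N := E.edge.n * k) (M := a * k + 1)
    (h.trans (by ring)) hG0 (Or.inl (hG1 ⟨hz, ha⟩)) (V := W * (r.aeval (X 1) + X 0 * R))
  have := (isUnit_of_dvd_unit (hfG.trans hd) hu).map (constantCoeff (σ := Fin 2) (R := K))
  exact this.ne_zero hf

theorem degree_le_card_of_isTypical {t : K} (h : E.IsTypical t) (s : Finset K)
    (hs : ∀ x ∈ E.curvettes t, x.1 ∈ s) : E.degree ≤ s.card := by
  have h1 : (Prod.fst '' E.curvettes t).encard = E.degree := by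
    rw [h.2.encard_image, h.1]
  have h2 : Prod.fst '' E.curvettes t ⊆ (s : Set K) := by
    rintro _ ⟨x, hx, rfl⟩
    exact hs x hx
  have h3 := Set.encard_le_encard h2
  rw [h1, Set.encard_coe_eq_coe_finsetCard] at h3
  exact_mod_cast h3

theorem edgePolyAt_ne_zero (hsep : E.q.derivative ≠ 0) (t : K) : E.edge.edgePolyAt t ≠ 0 := by
  intro h
  rw [edgePolyAt_eq] at h
  rcases mul_eq_zero.1 h with h | h
  · exact E.Q.constantCoeff_U_ne_zero (Polynomial.C_eq_zero.1 h)
  · apply hsep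
    rw [sub_eq_zero.1 h, Polynomial.derivative_C]

theorem derivative_edgePolyAt (t : K) : (E.edge.edgePolyAt t).derivative =
    Polynomial.C (constantCoeff E.Q.U) * E.q.derivative := by
  simp [edgePolyAt_eq]

theorem isAtypical_of_mem_criticalValues (hsep : E.q.derivative ≠ 0) {t : K}
    (ht : t ∈ E.criticalValues) : E.IsAtypical t := by
  classical
  obtain ⟨α, hα, rfl⟩ := ht
  intro htyp
  have hne := E.edgePolyAt_ne_zero hsep (E.q.eval α)
  have hle := E.degree_le_card_of_isTypical htyp
    (E.edge.edgePolyAt (E.q.eval α)).roots.toFinset fun x hx => by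
      rw [Multiset.mem_toFinset, Polynomial.mem_roots hne]
      exact E.eval_edgePolyAt_eq_zero_of_mem_curvettes hx
  have h1 := Multiset.toFinset_card_le (E.edge.edgePolyAt (E.q.eval α)).roots
  have h2 := Polynomial.card_roots' (E.edge.edgePolyAt (E.q.eval α))
  have h3 : _ ≤ E.degree := E.edge.natDegree_edgePolyAt_le (E.q.eval α)
  -- The chain `d_E ≤` distinct roots `≤` roots with multiplicity `≤ d_E` collapses, so all roots
  -- are simple.
  have hnd := Multiset.toFinset_card_eq_card_iff_nodup.1 (le_antisymm h1 (by omega))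
  have hlt := (Polynomial.one_lt_rootMultiplicity_iff_isRoot (t := α) hne).2
    ⟨by simp [edgePolyAt_eq], by rw [derivative_edgePolyAt]; simp [hα]⟩
  rw [← Polynomial.count_roots] at hlt
  exact absurd (Multiset.nodup_iff_count_le_one.1 hnd α) (not_le.2 hlt)

theorem isAtypical_eval_zero (hsep : E.q.derivative ≠ 0) (hn : 1 < E.vRatio) :
    E.IsAtypical (E.q.eval 0) := by
  classical
  by_cases hd : E.q.derivative.eval 0 = 0
  · exact E.isAtypical_of_mem_criticalValues hsep ⟨0, hd, rfl⟩
  intro htyp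
  have hne := E.edgePolyAt_ne_zero hsep (E.q.eval 0)
  have h0 : (E.edge.edgePolyAt (E.q.eval 0)).eval 0 = 0 := by simp [edgePolyAt_eq]
  have h1 : (E.edge.edgePolyAt (E.q.eval 0)).derivative.eval 0 ≠ 0 := by
    rw [derivative_edgePolyAt]
    simpa [hd] using E.Q.constantCoeff_U_ne_zero
  have hle := E.degree_le_card_of_isTypical htyp
    ((E.edge.edgePolyAt (E.q.eval 0)).roots.toFinset.erase 0) fun x hx => by
      rw [Finset.mem_erase, Multiset.mem_toFinset, Polynomial.mem_roots hne]
      exact ⟨E.fst_ne_zero_of_mem_curvettes hn h0 h1 hx,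
        E.eval_edgePolyAt_eq_zero_of_mem_curvettes hx⟩
  have hlt := Finset.card_erase_lt_of_mem (a := (0 : K))
    (s := (E.edge.edgePolyAt (E.q.eval 0)).roots.toFinset)
    (by rw [Multiset.mem_toFinset, Polynomial.mem_roots hne]; exact h0)
  have h2 := Multiset.toFinset_card_le (E.edge.edgePolyAt (E.q.eval 0)).roots
  have h3 := Polynomial.card_roots' (E.edge.edgePolyAt (E.q.eval 0))
  have h4 : _ ≤ E.degree := E.edge.natDegree_edgePolyAt_le (E.q.eval 0)
  omega

end Dicritical

end DicriticalPencil

theorem mainTheorem2 {K : Type*} [Field K] [IsAlgClosed K]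
    (P : DicriticalPencil.SpecialPencil K) (E : DicriticalPencil.Dicritical P)
    (hsep : E.q.derivative ≠ 0) :
    (∀ t ∈ E.criticalValues, E.IsAtypical t) ∧
      (1 < E.vRatio → E.IsAtypical (E.q.eval 0)) :=
  ⟨fun _ ht => E.isAtypical_of_mem_criticalValues hsep ht, E.isAtypical_eval_zero hsep⟩
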